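/- Let $\mathcal X$ and $\mathcal Y$ be finite sets, and let $P_{X,Y}$ be a probability mass function (pmf) on $\mathcal X\times\mathcal Y$ whose marginals satisfy $P_X(x)>0$ for all $x\in\mathcal X$ and $P_Y(y)>0$ for all $y\in\mathcal Y$. For pmfs $R,P$ on a finite set, let $D(R\|P)=\sum_x R(x)\log\frac{R(x)}{P(x)}$ be the KL divergence (natural logarithm) and $\chi^2(R\|P)=\sum_x\frac{(R(x)-P(x))^2}{P(x)}$ the $\chi^2$-divergence, both equal to $+\infty$ if $R(x)>0=P(x)$ for some $x$, and with terms for which $R(x)=P(x)=0$ counted as $0$. For jointly distributed finite-valued $U,V$ with $P_U$ the pmf of $U$ and $W$ the transition matrix of the channel $P_{V|U}$ (column $u$ of $W$ is $P_{V|U=u}$), define the contraction coefficients $$\eta_{\mathrm{KL}}(P_U,P_{V|U})=\sup_{R:\,0<D(R\|P_U)<\infty}\frac{D(WR\|WP_U)}{D(R\|P_U)},\qquad \eta_{\chi^2}(P_U,P_{V|U})=\sup_{R:\,0<\chi^2(R\|P_U)<\infty}\frac{\chi^2(WR\|WP_U)}{\chi^2(R\|P_U)},$$ where $R$ ranges over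 pmfs on the range of $U$ (and a supremum over the empty set is $0$). If $(X_1,Y_1),\dots,(X_n,Y_n)$ are i.i.d. with joint pmf $P_{X,Y}$, $X_1^n=(X_1,\dots,X_n)$ and $Y_1^n=(Y_1,\dots,Y_n)$, then $$\eta_{\chi^2}\!\left(P_{X_1^n},P_{Y_1^n|X_1^n}\right)\le\eta_{\mathrm{KL}}\!\left(P_{X_1^n},P_{Y_1^n|X_1^n}\right)\le\frac{\eta_{\chi^2}\!\left(P_{X_1^n},P_{Y_1^n|X_1^n}\right)}{\min_{x\in\mathcal X}P_X(x)}.$$ -/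

import Mathlib

open MeasureTheory ProbabilityTheory
open scoped ENNReal BigOperators Matrix

/-- For pmfs `R`, `P` with `R` vanishing wherever `P` does, the real sum defining the
KL divergence is nonnegative, so that `ENNReal.ofReal` below loses nothing. -/
theorem kl_sum_nonneg {α : Type*} [Fintype α] {R P : α → ℝ}
    (hR : R ∈ stdSimplex ℝ α) (hP : P ∈ stdSimplex ℝ α) (hac : ∀ x, P x = 0 → R x = 0) :
    0 ≤ ∑ x, R x * Real.log (R x / P x) := by
  have h : ∀ x, R x - P x ≤ R x * Real.log (R x / P x) := by
    intro x
    rcases (hR.1 x).eq_or_lt with h0 | h0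
    · have := hP.1 x
      rw [← h0]
      simpa using this
    · have hp : 0 < P x := lt_of_le_of_ne (hP.1 x) (fun h => h0.ne' (hac x h.symm))
      have h1 := Real.log_le_sub_one_of_pos (div_pos hp h0)
      have h2 : Real.log (R x / P x) = - Real.log (P x / R x) := by
        rw [← Real.log_inv, inv_div]
      have h3 : R x * (P x / R x) = P x := by field_simp
      rw [h2]
      nlinarith
  have hs : ∑ x, (R x - P x) = 0 := by
    rw [Finset.sum_sub_distrib, hR.2, hP.2, sub_self]
  calc (0 : ℝ) = ∑ x, (R x - P x) := hs.symm
    _ ≤ _ := Finset.sum_le_sum fun x _ => h x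

open scoped Classical in
/-- KL divergence `D(R‖P) = ∑ₓ R(x) log (R(x) / P(x))` (natural logarithm) of two pmfs on a
finite set, with the conventions `0 log (0/p) = 0` for `p ≥ 0` and `r log (r/0) = +∞` for
`r > 0`. -/
noncomputable def klDivergence {α : Type*} [Fintype α] (R P : α → ℝ) : ℝ≥0∞ :=
  if ∀ x, P x = 0 → R x = 0 then ENNReal.ofReal (∑ x, R x * Real.log (R x / P x)) else ⊤

open scoped Classical in
/-- `χ²`-divergence `χ²(R‖P) = ∑ₓ (R(x) - P(x))² / P(x)` of two pmfs on a finite set, where a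
term with `P(x) = 0` is `0` if `R(x) = 0` and `+∞` if `R(x) > 0`. -/
noncomputable def chiSqDivergence {α : Type*} [Fintype α] (R P : α → ℝ) : ℝ≥0∞ :=
  if ∀ x, P x = 0 → R x = 0 then ENNReal.ofReal (∑ x, (R x - P x) ^ 2 / P x) else ⊤

/-- Contraction coefficient for KL divergence of an input pmf `P` and a channel with column
stochastic transition matrix `W` (`W y x` is the probability of output `y` given input `x`).
The supremum is taken in `[0, ∞]`, so it is `0` when no `R` is admissible, that is, when the
input is almost surely constant; it is also `0` when the output is almost surely constant. -/
noncomputable def etaKL {α β : Type*} [Fintype α] [Fintype β]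
    (P : α → ℝ) (W : Matrix β α ℝ) : ℝ≥0∞ :=
  ⨆ R ∈ {R ∈ stdSimplex ℝ α | 0 < klDivergence R P ∧ klDivergence R P < ⊤},
    klDivergence (W *ᵥ R) (W *ᵥ P) / klDivergence R P

/-- Contraction coefficient for `χ²`-divergence of an input pmf `P` and a channel with column
stochastic transition matrix `W`. -/
noncomputable def etaChiSq {α β : Type*} [Fintype α] [Fintype β]
    (P : α → ℝ) (W : Matrix β α ℝ) : ℝ≥0∞ :=
  ⨆ R ∈ {R ∈ stdSimplex ℝ α | 0 < chiSqDivergence R P ∧ chiSqDivergence R P < ⊤},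
    chiSqDivergence (W *ᵥ R) (W *ᵥ P) / chiSqDivergence R P

/-- First marginal `P_X` of a joint pmf `P_{X,Y}`. -/
def marginalX {α β : Type*} [Fintype β] (P : α × β → ℝ) (x : α) : ℝ := ∑ y, P (x, y)

/-- Second marginal `P_Y` of a joint pmf `P_{X,Y}`. -/
def marginalY {α β : Type*} [Fintype α] (P : α × β → ℝ) (y : β) : ℝ := ∑ x, P (x, y)

/-- Transition matrix of the channel `P_{Y|X}`: the entry at `(y, x)` is
`P_{X,Y}(x, y) / P_X(x)`. -/
noncomputable def channel {α β : Type*} [Fintype β] (P : α × β → ℝ) : Matrix β α ℝ :=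
  Matrix.of fun y x => P (x, y) / marginalX P x

/-- Joint pmf of two discrete random variables `X` and `Y` on the probability space `(Ω, μ)`. -/
noncomputable def jointPmf {Ω α β : Type*} [MeasurableSpace Ω] (μ : Measure Ω)
    (X : Ω → α) (Y : Ω → β) : α × β → ℝ :=
  fun p => μ.real {ω | X ω = p.1 ∧ Y ω = p.2}

/-! Both bounds come from comparing the divergences. Locally `D(P + εJ‖P) ≈ ε² χ²/2`, so a KL
contraction inequality tested on `P + ε(R - P)` becomes, as `ε → 0`, the χ² inequality with the same
constant (`KLContracts.chiSqContracts`). This gives the lower bound for any channel.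

Conversely, with `m = min P_X`, `D(WR‖WP) ≤ χ²(WR‖WP) ≤ c χ²(R‖P)`, and Pinsker gives `m χ²(R‖P) ≤
D(R‖P)`. So χ² contraction with `c` yields KL contraction with `c / m`. Applied directly to `n`
letters this would cost `mⁿ`. Instead it is applied to one letter: χ² contraction of the `n`-fold
channel restricts to one letter (`ChiSqContracts.of_memoryless`), and KL contraction with `c / m`
tensorizes back to `n` letters (`KLContracts.memoryless`). -/

open Filter Topology

/-! ### Scalar estimates for the logarithm -/

/-- The Padé-type bound behind Pinsker's inequality. -/
theorem rational_le_log {x : ℝ} (hx : 0 < x) :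
    (5 * x ^ 2 - 4 * x - 1) / (2 * x ^ 2 + 4 * x) ≤ Real.log x := by
  set g : ℝ → ℝ := fun x => Real.log x - (5 * x ^ 2 - 4 * x - 1) / (2 * x ^ 2 + 4 * x) with hg
  -- The derivative of the difference has the sign of `y - 1`, so the difference has its minimum,
  -- zero, at `1`.
  have hd : ∀ y : ℝ, 0 < y → HasDerivAt g ((y - 1) ^ 3 / (y ^ 2 * (y + 2) ^ 2)) y := by
    intro y hy
    have hne : 2 * y ^ 2 + 4 * y ≠ 0 := by positivity
    have h1 : HasDerivAt (fun x : ℝ => 5 * x ^ 2 - 4 * x - 1) (10 * y - 4) y := by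
      have := (((hasDerivAt_id y).pow 2).const_mul 5).sub ((hasDerivAt_id y).const_mul 4)
        |>.sub_const 1
      convert! this using 1
      simp; ring
    have h2 : HasDerivAt (fun x : ℝ => 2 * x ^ 2 + 4 * x) (4 * y + 4) y := by
      have := (((hasDerivAt_id y).pow 2).const_mul 2).add ((hasDerivAt_id y).const_mul 4)
      convert! this using 1
      simp; ring
    convert! (Real.hasDerivAt_log hy.ne').sub (h1.div h2 hne) using 1
    field_simp
    ring
  have hc : ContinuousOn g (Set.Ioi 0) := fun y hy => (hd y hy).continuousAt.continuousWithinAt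
  have hg1 : g 1 = 0 := by norm_num [hg]
  have key : 0 ≤ g x := by
    rcases le_total 1 x with h | h
    · have hm : MonotoneOn g (Set.Ici 1) := by
        refine monotoneOn_of_deriv_nonneg (convex_Ici 1)
          (hc.mono fun y (hy : 1 ≤ y) => zero_lt_one.trans_le hy) ?_ ?_
        all_goals
          rw [interior_Ici]
          intro y (hy : 1 < y)
          have hy0 : 0 < y := by linarith
        · exact (hd y hy0).differentiableAt.differentiableWithinAt
        · rw [(hd y hy0).deriv]
          have : 0 ≤ y - 1 := by linarith
          positivity
      rw [← hg1]
      exact hm Set.self_mem_Ici h h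
    · have hm : AntitoneOn g (Set.Ioc 0 1) := by
        refine antitoneOn_of_deriv_nonpos (convex_Ioc 0 1) (hc.mono fun y hy => hy.1) ?_ ?_
        all_goals
          rw [interior_Ioc]
          intro y hy
        · exact (hd y hy.1).differentiableAt.differentiableWithinAt
        · rw [(hd y hy.1).deriv]
          refine div_nonpos_of_nonpos_of_nonneg ?_ (by positivity)
          have : y - 1 ≤ 0 := by linarith [hy.2]
          exact Odd.pow_nonpos (by decide) this
      rw [← hg1]
      exact hm ⟨hx, h⟩ ⟨one_pos, le_rfl⟩ h
  have : g x = Real.log x - (5 * x ^ 2 - 4 * x - 1) / (2 * x ^ 2 + 4 * x) := rfl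
  linarith

/-- This is `rational_le_log` at `r / p`, multiplied by `r`. Summed over pmfs, `r - p` cancels and
the weights `r + 2 * p` total `3`, which offsets the factor `3 / 2`. -/
theorem mul_log_div_lower_bound {r p : ℝ} (hr : 0 ≤ r) (hp : 0 < p) :
    r - p + 3 / 2 * ((r - p) ^ 2 / (r + 2 * p)) ≤ r * Real.log (r / p) := by
  rcases hr.eq_or_lt with rfl | hr
  · simp
    field_simp
    norm_num
  · have h := mul_le_mul_of_nonneg_left (rational_le_log (div_pos hr hp)) hr.le
    refine le_trans (le_of_eq ?_) h
    field_simp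
    ring

theorem mul_log_div_upper_bound {r p : ℝ} (hr : 0 ≤ r) (hp : 0 < p) :
    r * Real.log (r / p) ≤ r - p + (r - p) ^ 2 / p := by
  have h : r * Real.log (r / p) ≤ r * (r / p - 1) := by
    rcases hr.eq_or_lt with rfl | hr
    · simp
    · exact mul_le_mul_of_nonneg_left (Real.log_le_sub_one_of_pos (div_pos hr hp)) hr.le
  refine h.trans (le_of_eq ?_)
  field_simp
  ring

theorem abs_one_add_mul_log_sub_le {t : ℝ} (ht : |t| ≤ 1 / 2) :
    |(1 + t) * Real.log (1 + t) - t - t ^ 2 / 2| ≤ 4 * |t| ^ 3 := by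
  have h := Real.abs_log_sub_add_sum_range_le (x := -t) (by rw [abs_neg]; linarith) 2
  rw [abs_neg] at h
  have h2 : |t| ^ 3 / (1 - |t|) ≤ 2 * |t| ^ 3 := by
    rw [div_le_iff₀ (by linarith)]
    nlinarith [mul_nonneg (pow_nonneg (abs_nonneg t) 3) (sub_nonneg.2 ht)]
  replace h := h.trans h2
  simp only [Finset.sum_range_succ, Finset.sum_range_zero, sub_neg_eq_add] at h
  have ht' := abs_le.1 ht
  have e : (1 + t) * Real.log (1 + t) - t - t ^ 2 / 2 =
      (1 + t) * (-t + t ^ 2 / 2 + Real.log (1 + t)) + (-(t ^ 3 / 2)) := by ring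
  rw [e]
  refine (abs_add_le _ _).trans ?_
  rw [abs_mul, abs_neg, abs_div, abs_pow, abs_of_nonneg (by linarith : 0 ≤ 1 + t), abs_two]
  have h' : |-t + t ^ 2 / 2 + Real.log (1 + t)| ≤ 2 * |t| ^ 3 := by
    have e0 : -t + t ^ 2 / 2 =
        0 + (-t) ^ (0 + 1) / (((0 : ℕ) : ℝ) + 1) + (-t) ^ (1 + 1) / (((1 : ℕ) : ℝ) + 1) := by
      push_cast
      ring
    rw [e0]
    exact h
  have := mul_le_mul_of_nonneg_left h' (by linarith : 0 ≤ 1 + t)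
  -- Since `1 + t ≤ 3/2`, the error is at most `(3/2 · 2 + 1/2)|t|³`.
  nlinarith [pow_nonneg (abs_nonneg t) 3]

/-- Second-order Taylor expansion with cubic remainder. The linear term `ε * j` must be removed for
the limit to exist; it sums to zero over a perturbation of total mass zero. -/
theorem tendsto_mul_log_div_sq {p : ℝ} (hp : 0 < p) (j : ℝ) :
    Tendsto (fun ε : ℝ => ((p + ε * j) * Real.log ((p + ε * j) / p) - ε * j) / ε ^ 2)
      (𝓝[>] 0) (𝓝 (j ^ 2 / p / 2)) := by
  rw [tendsto_iff_norm_sub_tendsto_zero]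
  have hlim : Tendsto (fun ε : ℝ => 4 * p * |j / p| ^ 3 * ε) (𝓝[>] 0) (𝓝 0) := by
    have : Tendsto (fun ε : ℝ => 4 * p * |j / p| ^ 3 * ε) (𝓝 0) (𝓝 (4 * p * |j / p| ^ 3 * 0)) :=
      tendsto_id.const_mul _
    rw [mul_zero] at this
    exact this.mono_left nhdsWithin_le_nhds
  refine squeeze_zero' (Eventually.of_forall fun _ => norm_nonneg _) ?_ hlim
  have hsmall : ∀ᶠ ε : ℝ in 𝓝[>] 0, |ε * (j / p)| < 1 / 2 := by
    have : Tendsto (fun ε : ℝ => |ε * (j / p)|) (𝓝 0) (𝓝 |0 * (j / p)|) :=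
      (tendsto_id.mul_const _).abs
    rw [zero_mul, abs_zero] at this
    exact (this.mono_left nhdsWithin_le_nhds).eventually_lt_const (by norm_num)
  filter_upwards [hsmall, self_mem_nhdsWithin] with ε hε (hpos : 0 < ε)
  have h := abs_one_add_mul_log_sub_le hε.le
  have e1 : (p + ε * j) / p = 1 + ε * (j / p) := by field_simp
  have e2 : ((p + ε * j) * Real.log ((p + ε * j) / p) - ε * j) / ε ^ 2 - j ^ 2 / p / 2 =
      p / ε ^ 2 * ((1 + ε * (j / p)) * Real.log (1 + ε * (j / p)) - ε * (j / p)
        - (ε * (j / p)) ^ 2 / 2) := by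
    rw [e1]
    field_simp
  rw [Real.norm_eq_abs, e2, abs_mul, abs_of_pos (by positivity : 0 < p / ε ^ 2)]
  refine (mul_le_mul_of_nonneg_left h (by positivity)).trans (le_of_eq ?_)
  rw [abs_mul, abs_of_pos hpos]
  field_simp

/-- Log-sum inequality. -/
theorem log_sum_inequality {ι : Type*} (s : Finset ι) {a b : ι → ℝ} (ha : ∀ i ∈ s, 0 ≤ a i)
    (hb : ∀ i ∈ s, 0 ≤ b i) (hab : ∀ i ∈ s, b i = 0 → a i = 0) :
    (∑ i ∈ s, a i) * Real.log ((∑ i ∈ s, a i) / ∑ i ∈ s, b i) ≤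
      ∑ i ∈ s, a i * Real.log (a i / b i) := by
  set A := ∑ i ∈ s, a i with hA
  set B := ∑ i ∈ s, b i with hB
  rcases (Finset.sum_nonneg ha).eq_or_lt with h0 | h0
  · have hz := (Finset.sum_eq_zero_iff_of_nonneg ha).1 h0.symm
    rw [hA, ← h0, zero_mul]
    exact (Finset.sum_eq_zero fun i hi => by rw [hz i hi, zero_mul]).ge
  rw [← hA] at h0
  have hBpos : 0 < B := by
    refine (Finset.sum_nonneg hb).lt_of_ne fun h => h0.ne' ?_
    have hz := (Finset.sum_eq_zero_iff_of_nonneg hb).1 h.symm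
    exact Finset.sum_eq_zero fun i hi => hab i hi (hz i hi)
  -- Apply `1 - 1/u ≤ log u` to `u = (a i / b i) / (A / B)`; the corrections `a i - b i * (A / B)`
  -- sum to zero.
  have hterm : ∀ i ∈ s, a i * Real.log (A / B) + (a i - b i * (A / B)) ≤
      a i * Real.log (a i / b i) := by
    intro i hi
    rcases (ha i hi).eq_or_lt with h | h
    · rw [← h]
      have := mul_nonneg (hb i hi) (div_pos h0 hBpos).le
      simpa using this
    · have hbi : 0 < b i := (hb i hi).lt_of_ne fun hz => h.ne' (hab i hi hz.symm)
      have hl := Real.one_sub_inv_le_log_of_pos (div_pos (div_pos h hbi) (div_pos h0 hBpos))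
      rw [Real.log_div (div_pos h hbi).ne' (div_pos h0 hBpos).ne'] at hl
      have hm := mul_le_mul_of_nonneg_left hl h.le
      have e : a i * (1 - (a i / b i / (A / B))⁻¹) = a i - b i * (A / B) := by
        field_simp
      rw [e] at hm
      linarith
  calc A * Real.log (A / B) = ∑ i ∈ s, (a i * Real.log (A / B) + (a i - b i * (A / B))) := by
        rw [Finset.sum_add_distrib, Finset.sum_sub_distrib, ← Finset.sum_mul, ← Finset.sum_mul,
          ← hA, ← hB, mul_div_cancel₀ _ hBpos.ne']
        ring
    _ ≤ _ := Finset.sum_le_sum hterm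

/-! ### Real-valued divergences -/

/-- The real sum defining the KL divergence, for arbitrary (not necessarily normalized)
weights. -/
noncomputable def klSum {α : Type*} [Fintype α] (R P : α → ℝ) : ℝ :=
  ∑ x, R x * Real.log (R x / P x)

/-- The real sum defining the `χ²`-divergence. -/
noncomputable def chiSqSum {α : Type*} [Fintype α] (R P : α → ℝ) : ℝ :=
  ∑ x, (R x - P x) ^ 2 / P x

/-- `W` is a column stochastic matrix. -/
def IsColumnStochastic {α β : Type*} [Fintype β] (W : Matrix β α ℝ) : Prop :=
  (∀ y x, 0 ≤ W y x) ∧ ∀ x, ∑ y, W y x = 1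

section Basic

variable {α β : Type*} [Fintype α] [Fintype β]

theorem klDivergence_of_pos {P : α → ℝ} (hP : ∀ x, 0 < P x) (R : α → ℝ) :
    klDivergence R P = ENNReal.ofReal (klSum R P) :=
  if_pos fun x h => absurd h (hP x).ne'

theorem chiSqDivergence_of_pos {P : α → ℝ} (hP : ∀ x, 0 < P x) (R : α → ℝ) :
    chiSqDivergence R P = ENNReal.ofReal (chiSqSum R P) :=
  if_pos fun x h => absurd h (hP x).ne'

theorem klSum_nonneg {R P : α → ℝ} (hR : R ∈ stdSimplex ℝ α) (hP : P ∈ stdSimplex ℝ α)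
    (hpos : ∀ x, 0 < P x) : 0 ≤ klSum R P :=
  kl_sum_nonneg hR hP fun x h => absurd h (hpos x).ne'

theorem chiSqSum_nonneg {P : α → ℝ} (hpos : ∀ x, 0 < P x) (R : α → ℝ) : 0 ≤ chiSqSum R P :=
  Finset.sum_nonneg fun x _ => div_nonneg (sq_nonneg _) (hpos x).le

theorem klSum_self (P : α → ℝ) : klSum P P = 0 := by
  refine Finset.sum_eq_zero fun x _ => ?_
  rcases eq_or_ne (P x) 0 with h | h
  · rw [h, zero_mul]
  · rw [div_self h, Real.log_one, mul_zero]

theorem chiSqSum_self (P : α → ℝ) : chiSqSum P P = 0 := by simp [chiSqSum]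

theorem eq_of_chiSqSum_eq_zero {R P : α → ℝ} (hpos : ∀ x, 0 < P x) (h : chiSqSum R P = 0) :
    R = P := by
  have h' := (Finset.sum_eq_zero_iff_of_nonneg
    fun x _ => div_nonneg (sq_nonneg (R x - P x)) (hpos x).le).1 h
  funext x
  have := h' x (Finset.mem_univ x)
  rcases div_eq_zero_iff.1 this with h0 | h0
  · exact sub_eq_zero.1 (pow_eq_zero_iff two_ne_zero |>.1 h0)
  · exact absurd h0 (hpos x).ne'

theorem IsColumnStochastic.sum_mulVec {W : Matrix β α ℝ} (hW : IsColumnStochastic W)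
    (R : α → ℝ) : ∑ y, (W *ᵥ R) y = ∑ x, R x := by
  simp only [Matrix.mulVec, dotProduct]
  rw [Finset.sum_comm]
  refine Finset.sum_congr rfl fun x _ => ?_
  rw [← Finset.sum_mul, hW.2, one_mul]

theorem IsColumnStochastic.mulVec_nonneg {W : Matrix β α ℝ} (hW : IsColumnStochastic W)
    {R : α → ℝ} (hR : ∀ x, 0 ≤ R x) (y : β) : 0 ≤ (W *ᵥ R) y :=
  Finset.sum_nonneg fun x _ => mul_nonneg (hW.1 y x) (hR x)

theorem IsColumnStochastic.mulVec_mem {W : Matrix β α ℝ} (hW : IsColumnStochastic W)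
    {R : α → ℝ} (hR : R ∈ stdSimplex ℝ α) : W *ᵥ R ∈ stdSimplex ℝ β :=
  ⟨hW.mulVec_nonneg hR.1, (hW.sum_mulVec R).trans hR.2⟩

/-! ### Comparison of the two divergences -/

theorem klSum_le_chiSqSum {R P : α → ℝ} (hR : R ∈ stdSimplex ℝ α) (hP : P ∈ stdSimplex ℝ α)
    (hpos : ∀ x, 0 < P x) : klSum R P ≤ chiSqSum R P := by
  calc klSum R P ≤ ∑ x, (R x - P x + (R x - P x) ^ 2 / P x) :=
        Finset.sum_le_sum fun x _ => mul_log_div_upper_bound (hR.1 x) (hpos x)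
    _ = chiSqSum R P := by
        rw [Finset.sum_add_distrib, Finset.sum_sub_distrib, hR.2, hP.2, sub_self, zero_add]
        rfl

/-- Pinsker's inequality. -/
theorem pinsker {R P : α → ℝ} (hR : R ∈ stdSimplex ℝ α) (hP : P ∈ stdSimplex ℝ α)
    (hpos : ∀ x, 0 < P x) : (∑ x, |R x - P x|) ^ 2 / 2 ≤ klSum R P := by
  -- Cauchy–Schwarz with weights `R + 2P`, of total mass `3`.
  have h1 := Finset.sq_sum_div_le_sum_sq_div Finset.univ (fun x => |R x - P x|)
    (g := fun x => R x + 2 * P x)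
    fun x _ => by
      have := hR.1 x
      have := hpos x
      positivity
  have h2 : ∑ x, (R x + 2 * P x) = 3 := by
    rw [Finset.sum_add_distrib, ← Finset.mul_sum, hR.2, hP.2]
    norm_num
  simp only [sq_abs, h2] at h1
  calc (∑ x, |R x - P x|) ^ 2 / 2 = 3 / 2 * ((∑ x, |R x - P x|) ^ 2 / 3) := by ring
    _ ≤ 3 / 2 * ∑ x, (R x - P x) ^ 2 / (R x + 2 * P x) := by gcongr
    _ = ∑ x, (R x - P x + 3 / 2 * ((R x - P x) ^ 2 / (R x + 2 * P x))) := by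
        rw [Finset.sum_add_distrib, Finset.sum_sub_distrib, hR.2, hP.2, sub_self, zero_add,
          Finset.mul_sum]
    _ ≤ klSum R P := Finset.sum_le_sum fun x _ => mul_log_div_lower_bound (hR.1 x) (hpos x)

/-- For a vector of total sum zero, `‖v‖₂² ≤ ‖v‖₁² / 2`. -/
theorem sum_sq_le_sq_sum_abs_div_two {v : α → ℝ} (hv : ∑ x, v x = 0) :
    ∑ x, v x ^ 2 ≤ (∑ x, |v x|) ^ 2 / 2 := by
  classical
  -- Each entry is minus the sum of the others, so it carries at most half of the `ℓ¹` norm.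
  have hbound : ∀ x, |v x| ≤ (∑ x, |v x|) / 2 := by
    intro x
    have h1 := Finset.add_sum_erase Finset.univ v (Finset.mem_univ x)
    have h2 := Finset.add_sum_erase Finset.univ (fun x => |v x|) (Finset.mem_univ x)
    have h3 := Finset.abs_sum_le_sum_abs v (Finset.univ.erase x)
    have h4 : v x = -∑ x ∈ Finset.univ.erase x, v x := by linarith
    rw [← abs_neg, ← h4] at h3
    linarith
  calc ∑ x, v x ^ 2 = ∑ x, |v x| * |v x| :=
        Finset.sum_congr rfl fun x _ => by rw [← sq_abs, sq]
    _ ≤ ∑ x, |v x| * ((∑ x, |v x|) / 2) :=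
        Finset.sum_le_sum fun x _ => mul_le_mul_of_nonneg_left (hbound x) (abs_nonneg _)
    _ = _ := by
        rw [← Finset.sum_mul]
        ring

/-- The bound `m ≤ P` reduces χ² to `‖R - P‖₂²`. The factor `1/2` gained from `R - P` having sum
zero matches the one in Pinsker, so the constant is `m` rather than `m / 2`. -/
theorem mul_chiSqSum_le_klSum {R P : α → ℝ} (hR : R ∈ stdSimplex ℝ α)
    (hP : P ∈ stdSimplex ℝ α) (hpos : ∀ x, 0 < P x) {m : ℝ} (hm : ∀ x, m ≤ P x) :
    m * chiSqSum R P ≤ klSum R P := by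
  have hs : ∑ x, (R x - P x) = 0 := by rw [Finset.sum_sub_distrib, hR.2, hP.2, sub_self]
  calc m * chiSqSum R P = ∑ x, m * ((R x - P x) ^ 2 / P x) := Finset.mul_sum _ _ _
    _ ≤ ∑ x, (R x - P x) ^ 2 := by
        refine Finset.sum_le_sum fun x _ => ?_
        rw [mul_div_assoc', div_le_iff₀ (hpos x), mul_comm]
        exact mul_le_mul_of_nonneg_left (hm x) (sq_nonneg _)
    _ ≤ (∑ x, |R x - P x|) ^ 2 / 2 := sum_sq_le_sq_sum_abs_div_two hs
    _ ≤ klSum R P := pinsker hR hP hpos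

/-- Locally, the KL divergence is half the `χ²`-divergence. -/
theorem tendsto_klSum_div_sq {P : α → ℝ} (hpos : ∀ x, 0 < P x) {J : α → ℝ}
    (hJ : ∑ x, J x = 0) :
    Tendsto (fun ε : ℝ => klSum (P + ε • J) P / ε ^ 2) (𝓝[>] 0)
      (𝓝 ((∑ x, J x ^ 2 / P x) / 2)) := by
  have h : Tendsto (fun ε : ℝ =>
      ∑ x, ((P x + ε * J x) * Real.log ((P x + ε * J x) / P x) - ε * J x) / ε ^ 2) (𝓝[>] 0)
      (𝓝 (∑ x, J x ^ 2 / P x / 2)) :=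
    tendsto_finsetSum _ fun x _ => tendsto_mul_log_div_sq (hpos x) (J x)
  rw [Finset.sum_div]
  refine h.congr fun ε => ?_
  rw [← Finset.sum_div, Finset.sum_sub_distrib, ← Finset.mul_sum, hJ, mul_zero, sub_zero]
  rfl

/-! ### Contraction inequalities and contraction coefficients -/

/-- The KL contraction inequality with constant `c`. -/
def KLContracts (P : α → ℝ) (W : Matrix β α ℝ) (c : ℝ) : Prop :=
  ∀ R ∈ stdSimplex ℝ α, klSum (W *ᵥ R) (W *ᵥ P) ≤ c * klSum R P

/-- The `χ²` contraction inequality with constant `c`. -/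
def ChiSqContracts (P : α → ℝ) (W : Matrix β α ℝ) (c : ℝ) : Prop :=
  ∀ R ∈ stdSimplex ℝ α, chiSqSum (W *ᵥ R) (W *ᵥ P) ≤ c * chiSqSum R P

theorem ofReal_le_mul_of_div_le {a b : ℝ} (hb : 0 < b) {s : ℝ≥0∞} (hs : s ≠ ⊤)
    (h : ENNReal.ofReal a / ENNReal.ofReal b ≤ s) : a ≤ s.toReal * b := by
  rw [ENNReal.div_le_iff (by simpa using hb) ENNReal.ofReal_ne_top,
    ← ENNReal.ofReal_toReal hs, ← ENNReal.ofReal_mul ENNReal.toReal_nonneg] at h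
  exact (ENNReal.ofReal_le_ofReal_iff (by positivity)).1 h

theorem ofReal_div_le_of_le_mul {a b c : ℝ} (hb : 0 < b) (h : a ≤ c * b) :
    ENNReal.ofReal a / ENNReal.ofReal b ≤ ENNReal.ofReal c := by
  rw [ENNReal.div_le_iff (by simpa using hb) ENNReal.ofReal_ne_top, ← ENNReal.ofReal_mul' hb.le]
  exact ENNReal.ofReal_le_ofReal h

theorem etaKL_le {P : α → ℝ} {W : Matrix β α ℝ} (hpos : ∀ x, 0 < P x)
    (hWpos : ∀ y, 0 < (W *ᵥ P) y) {c : ℝ} (h : KLContracts P W c) :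
    etaKL P W ≤ ENNReal.ofReal c := by
  refine iSup₂_le fun R hR => ?_
  obtain ⟨hR, h0, -⟩ := hR
  rw [klDivergence_of_pos hpos] at h0 ⊢
  rw [klDivergence_of_pos hWpos]
  exact ofReal_div_le_of_le_mul (ENNReal.ofReal_pos.1 h0) (h R hR)

theorem etaChiSq_le {P : α → ℝ} {W : Matrix β α ℝ} (hpos : ∀ x, 0 < P x)
    (hWpos : ∀ y, 0 < (W *ᵥ P) y) {c : ℝ} (h : ChiSqContracts P W c) :
    etaChiSq P W ≤ ENNReal.ofReal c := by
  refine iSup₂_le fun R hR => ?_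
  obtain ⟨hR, h0, -⟩ := hR
  rw [chiSqDivergence_of_pos hpos] at h0 ⊢
  rw [chiSqDivergence_of_pos hWpos]
  exact ofReal_div_le_of_le_mul (ENNReal.ofReal_pos.1 h0) (h R hR)

/-- A finite supremum is itself an admissible constant: the only pmf excluded from it is `R = P`,
where both sides vanish. -/
theorem chiSqContracts_toReal_etaChiSq {P : α → ℝ} {W : Matrix β α ℝ} (hpos : ∀ x, 0 < P x)
    (hWpos : ∀ y, 0 < (W *ᵥ P) y) (hfin : etaChiSq P W ≠ ⊤) :
    ChiSqContracts P W (etaChiSq P W).toReal := by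
  intro R hR
  rcases (chiSqSum_nonneg hpos R).eq_or_lt with h | h
  · rw [eq_of_chiSqSum_eq_zero hpos h.symm, chiSqSum_self, chiSqSum_self, mul_zero]
  · refine ofReal_le_mul_of_div_le h hfin ?_
    rw [← chiSqDivergence_of_pos hpos, ← chiSqDivergence_of_pos hWpos]
    refine le_iSup₂_of_le (f := fun R (_ : R ∈ {R ∈ stdSimplex ℝ α |
      0 < chiSqDivergence R P ∧ chiSqDivergence R P < ⊤}) =>
      chiSqDivergence (W *ᵥ R) (W *ᵥ P) / chiSqDivergence R P) R ⟨hR, ?_, ?_⟩ le_rfl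
    · rwa [chiSqDivergence_of_pos hpos, ENNReal.ofReal_pos]
    · rw [chiSqDivergence_of_pos hpos]
      exact ENNReal.ofReal_lt_top

theorem klContracts_toReal_etaKL {P : α → ℝ} {W : Matrix β α ℝ} (hP : P ∈ stdSimplex ℝ α)
    (hpos : ∀ x, 0 < P x) (hWpos : ∀ y, 0 < (W *ᵥ P) y) (hfin : etaKL P W ≠ ⊤) :
    KLContracts P W (etaKL P W).toReal := by
  intro R hR
  rcases (klSum_nonneg hR hP hpos).eq_or_lt with h | h
  -- Zero KL divergence forces equality, by Pinsker.
  · have hR' : R = P := by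
      have h1 := pinsker hR hP hpos
      rw [← h] at h1
      have h2 : ∑ x, |R x - P x| = 0 := by
        have := sq_nonneg (∑ x, |R x - P x|)
        exact pow_eq_zero_iff two_ne_zero |>.1 (by linarith)
      funext x
      have := (Finset.sum_eq_zero_iff_of_nonneg fun x _ => abs_nonneg (R x - P x)).1 h2 x
        (Finset.mem_univ x)
      exact sub_eq_zero.1 (abs_eq_zero.1 this)
    rw [hR', klSum_self, klSum_self, mul_zero]
  · refine ofReal_le_mul_of_div_le h hfin ?_
    rw [← klDivergence_of_pos hpos, ← klDivergence_of_pos hWpos]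
    refine le_iSup₂_of_le (f := fun R (_ : R ∈ {R ∈ stdSimplex ℝ α |
      0 < klDivergence R P ∧ klDivergence R P < ⊤}) =>
      klDivergence (W *ᵥ R) (W *ᵥ P) / klDivergence R P) R ⟨hR, ?_, ?_⟩ le_rfl
    · rwa [klDivergence_of_pos hpos, ENNReal.ofReal_pos]
    · rw [klDivergence_of_pos hpos]
      exact ENNReal.ofReal_lt_top

/-- Contraction of the KL divergence implies contraction of the `χ²`-divergence. -/
theorem KLContracts.chiSqContracts {P : α → ℝ} {W : Matrix β α ℝ} {c : ℝ}
    (hP : P ∈ stdSimplex ℝ α) (hpos : ∀ x, 0 < P x) (hW : IsColumnStochastic W)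
    (hWpos : ∀ y, 0 < (W *ᵥ P) y) (h : KLContracts P W c) : ChiSqContracts P W c := by
  intro R hR
  have hJ : ∑ x, (R - P) x = 0 := by
    simp only [Pi.sub_apply]
    rw [Finset.sum_sub_distrib, hR.2, hP.2, sub_self]
  have hWJ : ∑ y, (W *ᵥ (R - P)) y = 0 := by rw [hW.sum_mulVec, hJ]
  -- Divide the KL inequality at `P + ε(R - P)` by `ε²` and let `ε → 0⁺`; each side tends to half of
  -- the corresponding χ² side.
  have h1 := tendsto_klSum_div_sq hWpos hWJ
  have h2 := (tendsto_klSum_div_sq hpos hJ).const_mul c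
  have hle : (∑ y, (W *ᵥ (R - P)) y ^ 2 / (W *ᵥ P) y) / 2 ≤
      c * ((∑ x, (R - P) x ^ 2 / P x) / 2) := by
    refine le_of_tendsto_of_tendsto h1 h2 ?_
    have hone : ∀ᶠ ε : ℝ in 𝓝[>] 0, ε < 1 :=
      (eventually_lt_nhds one_pos).filter_mono nhdsWithin_le_nhds
    filter_upwards [self_mem_nhdsWithin, hone] with ε (hε : 0 < ε) hε1
    have hmem : P + ε • (R - P) ∈ stdSimplex ℝ α :=
      (convex_stdSimplex ℝ α).add_smul_sub_mem hP hR ⟨hε.le, hε1.le⟩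
    have := h _ hmem
    rw [Matrix.mulVec_add, Matrix.mulVec_smul] at this
    rw [← mul_div_assoc]
    gcongr
  have e1 : chiSqSum (W *ᵥ R) (W *ᵥ P) = ∑ y, (W *ᵥ (R - P)) y ^ 2 / (W *ᵥ P) y := by
    rw [Matrix.mulVec_sub]
    rfl
  have e2 : chiSqSum R P = ∑ x, (R - P) x ^ 2 / P x := rfl
  rw [e1, e2]
  linarith

theorem etaChiSq_le_etaKL {P : α → ℝ} {W : Matrix β α ℝ}
    (hP : P ∈ stdSimplex ℝ α) (hpos : ∀ x, 0 < P x) (hW : IsColumnStochastic W)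
    (hWpos : ∀ y, 0 < (W *ᵥ P) y) : etaChiSq P W ≤ etaKL P W := by
  by_cases hfin : etaKL P W = ⊤
  · exact hfin ▸ le_top
  · rw [← ENNReal.ofReal_toReal hfin]
    exact etaChiSq_le hpos hWpos
      ((klContracts_toReal_etaKL hP hpos hWpos hfin).chiSqContracts hP hpos hW hWpos)

/-- Contraction of the `χ²`-divergence with constant `c` implies contraction of the KL
divergence with constant `c / min P`. -/
theorem ChiSqContracts.klContracts {P : α → ℝ} {W : Matrix β α ℝ} {c m : ℝ}
    (hP : P ∈ stdSimplex ℝ α) (hpos : ∀ x, 0 < P x) (hW : IsColumnStochastic W)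
    (hWpos : ∀ y, 0 < (W *ᵥ P) y) (hc : 0 ≤ c) (hm0 : 0 < m) (hm : ∀ x, m ≤ P x)
    (h : ChiSqContracts P W c) : KLContracts P W (c / m) := by
  intro R hR
  calc klSum (W *ᵥ R) (W *ᵥ P) ≤ chiSqSum (W *ᵥ R) (W *ᵥ P) :=
        klSum_le_chiSqSum (hW.mulVec_mem hR) (hW.mulVec_mem hP) hWpos
    _ ≤ c * chiSqSum R P := h R hR
    _ = c / m * (m * chiSqSum R P) := by field_simp
    _ ≤ c / m * klSum R P :=
        mul_le_mul_of_nonneg_left (mul_chiSqSum_le_klSum hR hP hpos hm) (by positivity)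

end Basic

/-! ### Tensorization of the KL contraction inequality -/

section Tensor

open scoped Kronecker

variable {α β γ δ : Type*} [Fintype α] [Fintype β] [Fintype γ] [Fintype δ]

/-- Homogeneity allows unnormalized slices `Q (x, ·)` in place of conditional pmfs, so a vanishing
marginal causes no division. -/
theorem klSum_smul {s : ℝ} (hs : s ≠ 0) (R P : α → ℝ) :
    klSum (s • R) (s • P) = s * klSum R P := by
  simp only [klSum, Pi.smul_apply, smul_eq_mul, Finset.mul_sum]
  refine Finset.sum_congr rfl fun x _ => ?_
  rw [mul_div_mul_left _ _ hs, mul_assoc]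

theorem klSum_zero_left (P : α → ℝ) : klSum 0 P = 0 := by simp [klSum]

/-- Homogeneous form of the contraction inequality. -/
theorem KLContracts.of_nonneg {P : α → ℝ} {W : Matrix β α ℝ} {c : ℝ} (h : KLContracts P W c)
    {q : α → ℝ} (hq : ∀ x, 0 ≤ q x) :
    klSum (W *ᵥ q) ((∑ x, q x) • (W *ᵥ P)) ≤ c * klSum q ((∑ x, q x) • P) := by
  rcases (Finset.sum_nonneg fun x (_ : x ∈ Finset.univ) => hq x).eq_or_lt with h0 | h0
  · have : q = 0 := funext fun x =>
      (Finset.sum_eq_zero_iff_of_nonneg fun x _ => hq x).1 h0.symm x (Finset.mem_univ x)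
    rw [this, Matrix.mulVec_zero, klSum_zero_left, klSum_zero_left, mul_zero]
  · set s := ∑ x, q x with hs
    have hR : s⁻¹ • q ∈ stdSimplex ℝ α := by
      refine ⟨fun x => mul_nonneg (inv_nonneg.2 h0.le) (hq x), ?_⟩
      simp only [Pi.smul_apply, smul_eq_mul]
      rw [← Finset.mul_sum, ← hs, inv_mul_cancel₀ h0.ne']
    have hqs : q = s • (s⁻¹ • q) := by rw [smul_smul, mul_inv_cancel₀ h0.ne', one_smul]
    rw [hqs, Matrix.mulVec_smul, klSum_smul h0.ne', klSum_smul h0.ne', mul_left_comm]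
    exact mul_le_mul_of_nonneg_left (h _ hR) h0.le

/-- Chain rule for the KL divergence relative to a product. -/
theorem klSum_prod {P₁ : α → ℝ} {P₂ : β → ℝ} (h₁ : ∀ x, 0 < P₁ x) (h₂ : ∀ y, 0 < P₂ y)
    {Q : α × β → ℝ} (hQ : ∀ p, 0 ≤ Q p) :
    klSum Q (fun p => P₁ p.1 * P₂ p.2) =
      klSum (marginalX Q) P₁ + ∑ x, klSum (fun y => Q (x, y)) (marginalX Q x • P₂) := by
  simp only [klSum, Fintype.sum_prod_type, ← Finset.sum_add_distrib]
  refine Finset.sum_congr rfl fun x _ => ?_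
  conv_rhs => rw [marginalX, Finset.sum_mul, ← Finset.sum_add_distrib]
  refine Finset.sum_congr rfl fun y _ => ?_
  rcases (hQ (x, y)).eq_or_lt with h | h
  · simp [← h]
  · have hm : 0 < ∑ y, Q (x, y) :=
      h.trans_le (Finset.single_le_sum (fun y _ => hQ (x, y)) (Finset.mem_univ y))
    have := (h₁ x).ne'
    have := (h₂ y).ne'
    simp only [Pi.smul_apply, smul_eq_mul]
    rw [← mul_add, ← Real.log_mul (div_pos hm (h₁ x)).ne' (div_pos h (mul_pos hm (h₂ y))).ne']
    congr 2
    field_simp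

theorem kronecker_mulVec_prod {ι κ : Type*} (W₁ : Matrix ι α ℝ) (W₂ : Matrix κ β ℝ) (P₁ : α → ℝ)
    (P₂ : β → ℝ) :
    (W₁ ⊗ₖ W₂) *ᵥ (fun p => P₁ p.1 * P₂ p.2) = fun p => (W₁ *ᵥ P₁) p.1 * (W₂ *ᵥ P₂) p.2 := by
  funext p
  simp only [Matrix.mulVec, dotProduct, Matrix.kroneckerMap_apply, Fintype.sum_prod_type,
    Finset.sum_mul_sum]
  exact Finset.sum_congr rfl fun _ _ => Finset.sum_congr rfl fun _ _ => by ring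

/-- The KL contraction inequality tensorizes. -/
theorem KLContracts.kronecker {P₁ : α → ℝ} {P₂ : β → ℝ} {W₁ : Matrix γ α ℝ}
    {W₂ : Matrix δ β ℝ} {c : ℝ} (hc : 0 ≤ c) (hP₁ : ∀ x, 0 < P₁ x) (hP₂ : ∀ x, 0 < P₂ x)
    (hW₁ : IsColumnStochastic W₁) (hW₂ : IsColumnStochastic W₂)
    (hWP₁ : ∀ y, 0 < (W₁ *ᵥ P₁) y) (hWP₂ : ∀ y, 0 < (W₂ *ᵥ P₂) y)
    (h₁ : KLContracts P₁ W₁ c) (h₂ : KLContracts P₂ W₂ c) :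
    KLContracts (fun p : α × β => P₁ p.1 * P₂ p.2) (W₁ ⊗ₖ W₂) c := by
  intro Q hQ
  set Q₁ := marginalX Q with hQ₁
  have hQ₁0 : ∀ x, 0 ≤ Q₁ x := fun x => Finset.sum_nonneg fun y _ => hQ.1 (x, y)
  have hQ₁mem : Q₁ ∈ stdSimplex ℝ α :=
    ⟨hQ₁0, by rw [← hQ.2, Fintype.sum_prod_type]; rfl⟩
  -- `V` is the joint law of first output and second input: only `W₁` has acted.
  set V : γ → β → ℝ := fun y b => ∑ x, W₁ y x * Q (x, b) with hV
  have hV0 : ∀ y b, 0 ≤ V y b := fun y b =>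
    Finset.sum_nonneg fun x _ => mul_nonneg (hW₁.1 y x) (hQ.1 _)
  have hVsum : ∀ y, ∑ b, V y b = (W₁ *ᵥ Q₁) y := by
    intro y
    simp only [hV, Matrix.mulVec, dotProduct, hQ₁, marginalX, Finset.mul_sum]
    exact Finset.sum_comm
  have hZ : ∀ y z, ((W₁ ⊗ₖ W₂) *ᵥ Q) (y, z) = (W₂ *ᵥ V y) z := by
    intro y z
    simp only [Matrix.mulVec, dotProduct, Matrix.kroneckerMap_apply, Fintype.sum_prod_type, hV,
      Finset.mul_sum]
    rw [Finset.sum_comm]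
    exact Finset.sum_congr rfl fun _ _ => Finset.sum_congr rfl fun _ _ => by ring
  have hZ0 : ∀ p, 0 ≤ ((W₁ ⊗ₖ W₂) *ᵥ Q) p := fun p => by
    rw [hZ p.1 p.2]
    exact hW₂.mulVec_nonneg (hV0 p.1) p.2
  have hZ1 : marginalX ((W₁ ⊗ₖ W₂) *ᵥ Q) = W₁ *ᵥ Q₁ := by
    funext y
    simp only [marginalX, hZ]
    rw [hW₂.sum_mulVec, hVsum]
  -- Joint convexity of KL, as the log-sum inequality over `x` at each `b`: mixing slices through
  -- `W₁` does not increase divergence.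
  have hslice : ∀ y, klSum (V y) ((W₁ *ᵥ Q₁) y • P₂) ≤
      ∑ x, W₁ y x * klSum (fun b => Q (x, b)) (Q₁ x • P₂) := by
    intro y
    simp only [klSum, Finset.mul_sum]
    rw [Finset.sum_comm]
    refine Finset.sum_le_sum fun b _ => ?_
    have hls := log_sum_inequality Finset.univ (a := fun x => W₁ y x * Q (x, b))
      (b := fun x => W₁ y x * (Q₁ x * P₂ b))
      (fun x _ => mul_nonneg (hW₁.1 y x) (hQ.1 _))
      (fun x _ => mul_nonneg (hW₁.1 y x) (mul_nonneg (hQ₁0 x) (hP₂ b).le))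
      (fun x _ hx => by
        rcases mul_eq_zero.1 hx with h | h
        · rw [h, zero_mul]
        · have hq : Q₁ x = 0 := (mul_eq_zero.1 h).resolve_right (hP₂ b).ne'
          have := (Finset.sum_eq_zero_iff_of_nonneg fun b _ => hQ.1 (x, b)).1 hq b
            (Finset.mem_univ b)
          rw [this, mul_zero])
    have e : ∑ x, W₁ y x * (Q₁ x * P₂ b) = ((W₁ *ᵥ Q₁) y • P₂) b := by
      simp only [Matrix.mulVec, dotProduct, Pi.smul_apply, smul_eq_mul, Finset.sum_mul, mul_assoc]
    rw [e] at hls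
    refine hls.trans (le_of_eq (Finset.sum_congr rfl fun x _ => ?_))
    rcases eq_or_ne (W₁ y x) 0 with h | h
    · rw [h, zero_mul, zero_mul, zero_mul]
    · rw [mul_div_mul_left _ _ h, mul_assoc]
      rfl
  rw [kronecker_mulVec_prod, klSum_prod hWP₁ hWP₂ hZ0, klSum_prod hP₁ hP₂ hQ.1, hZ1]
  -- With the chain rule at input and output, `h₁` handles the first marginal and `h₂` the slices `V
  -- y`. The mixing by `W₁` is then undone using `hslice` and unit column sums.
  calc klSum (W₁ *ᵥ Q₁) (W₁ *ᵥ P₁) +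
        ∑ y, klSum (fun z => ((W₁ ⊗ₖ W₂) *ᵥ Q) (y, z)) ((W₁ *ᵥ Q₁) y • (W₂ *ᵥ P₂))
      ≤ c * klSum Q₁ P₁ + ∑ y, c * klSum (V y) ((W₁ *ᵥ Q₁) y • P₂) := by
        refine add_le_add (h₁ Q₁ hQ₁mem) (Finset.sum_le_sum fun y _ => ?_)
        simp only [hZ]
        rw [← hVsum]
        exact h₂.of_nonneg (hV0 y)
    _ ≤ c * klSum Q₁ P₁ +
        ∑ y, c * ∑ x, W₁ y x * klSum (fun b => Q (x, b)) (Q₁ x • P₂) := by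
        gcongr with y
        exact hslice y
    _ = c * (klSum Q₁ P₁ + ∑ x, klSum (fun b => Q (x, b)) (Q₁ x • P₂)) := by
        rw [← Finset.mul_sum, Finset.sum_comm, mul_add]
        congr 2
        refine Finset.sum_congr rfl fun x _ => ?_
        rw [← Finset.sum_mul, hW₁.2, one_mul]

theorem klSum_comp_equiv (e : α ≃ β) (R P : β → ℝ) : klSum (R ∘ e) (P ∘ e) = klSum R P :=
  e.sum_comp fun y => R y * Real.log (R y / P y)

/-- The KL contraction inequality is invariant under relabelling input and output. -/
theorem KLContracts.of_submatrix {P : α → ℝ} {W : Matrix γ α ℝ} {c : ℝ} (e : β ≃ α) (f : δ ≃ γ)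
    (h : KLContracts (P ∘ e) (W.submatrix f e) c) : KLContracts P W c := by
  have hmul : ∀ R : α → ℝ, (W.submatrix f e) *ᵥ (R ∘ e) = (W *ᵥ R) ∘ f := by
    intro R
    funext y
    exact e.sum_comp fun x => W (f y) x * R x
  intro R hR
  have hR' : R ∘ e ∈ stdSimplex ℝ β := ⟨fun x => hR.1 _, (e.sum_comp R).trans hR.2⟩
  have := h _ hR'
  rwa [hmul, hmul, klSum_comp_equiv, klSum_comp_equiv] at this

end Tensor

/-! ### Memoryless extensions -/

section Memoryless

variable {α β : Type*} [Fintype α] [Fintype β]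

/-- The `n`-fold memoryless extension of a channel. -/
def memorylessChannel (n : ℕ) (W : Matrix β α ℝ) : Matrix (Fin n → β) (Fin n → α) ℝ :=
  Matrix.of fun y x => ∏ i, W (y i) (x i)

theorem memoryless_mulVec_prod {γ : Type*} {n : ℕ} (W : Matrix γ α ℝ) (R : Fin n → α → ℝ) :
    memorylessChannel n W *ᵥ (fun x => ∏ i, R i (x i)) = fun y => ∏ i, (W *ᵥ R i) (y i) := by
  funext y
  simp only [Matrix.mulVec, dotProduct, memorylessChannel, Matrix.of_apply, ← Finset.prod_mul_distrib]
  exact (Fintype.prod_sum fun i x => W (y i) x * R i x).symm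

theorem prod_mem_stdSimplex {n : ℕ} {R : Fin n → α → ℝ} (hR : ∀ i, R i ∈ stdSimplex ℝ α) :
    (fun x : Fin n → α => ∏ i, R i (x i)) ∈ stdSimplex ℝ (Fin n → α) := by
  refine ⟨fun x => Finset.prod_nonneg fun i _ => (hR i).1 _, ?_⟩
  rw [← Fintype.prod_sum]
  exact Finset.prod_eq_one fun i _ => (hR i).2

theorem IsColumnStochastic.memoryless {W : Matrix β α ℝ} (hW : IsColumnStochastic W) (n : ℕ) :
    IsColumnStochastic (memorylessChannel n W) := by
  refine ⟨fun y x => ?_, fun x => ?_⟩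
  · rw [memorylessChannel, Matrix.of_apply]
    exact Finset.prod_nonneg fun i _ => hW.1 _ _
  refine (Fintype.prod_sum fun i y => W y (x i)).symm.trans ?_
  exact Finset.prod_eq_one fun i _ => hW.2 _

theorem KLContracts.memoryless {P : α → ℝ} {W : Matrix β α ℝ} {c : ℝ} (hc : 0 ≤ c)
    (hpos : ∀ x, 0 < P x) (hW : IsColumnStochastic W)
    (hWpos : ∀ y, 0 < (W *ᵥ P) y) (h : KLContracts P W c) (n : ℕ) :
    KLContracts (fun x : Fin n → α => ∏ i, P (x i)) (memorylessChannel n W) c := by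
  induction n with
  | zero =>
    intro R hR
    have hR1 : R = fun x : Fin 0 → α => ∏ i, P (x i) := by
      funext x
      have := hR.2
      rw [Fintype.sum_unique] at this
      rw [Subsingleton.elim x default, this]
      simp
    rw [hR1, klSum_self, klSum_self, mul_zero]
  | succ n ih =>
    have hWn : ∀ y, 0 < (memorylessChannel n W *ᵥ fun x : Fin n → α => ∏ i, P (x i)) y := by
      intro y
      rw [memoryless_mulVec_prod W fun _ => P]
      exact Finset.prod_pos fun i _ => hWpos _
    have hk := KLContracts.kronecker hc hpos (fun x => Finset.prod_pos fun i _ => hpos (x i)) hW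
      (hW.memoryless n) hWpos hWn h ih
    -- Splitting off the first letter identifies the `(n + 1)`-fold extension with a Kronecker
    -- product.
    refine KLContracts.of_submatrix (Fin.consEquiv fun _ => α) (Fin.consEquiv fun _ => β) ?_
    convert hk using 1
    · funext p
      simp [Fin.consEquiv, Fin.prod_univ_succ]
    · ext p q
      simp [Fin.consEquiv, Fin.prod_univ_succ, memorylessChannel]

/-- Unlike χ² itself, `∑ R² / P` factorizes over product pmfs. -/
theorem chiSqSum_eq_sum_sq_div_sub_one {R P : α → ℝ} (hR : R ∈ stdSimplex ℝ α)
    (hP : P ∈ stdSimplex ℝ α) (hpos : ∀ x, 0 < P x) :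
    chiSqSum R P = ∑ x, R x ^ 2 / P x - 1 := by
  have : ∀ x, (R x - P x) ^ 2 / P x = R x ^ 2 / P x - 2 * R x + P x := fun x => by
    have := (hpos x).ne'
    field_simp
    ring
  simp only [chiSqSum, this]
  rw [Finset.sum_add_distrib, Finset.sum_sub_distrib, ← Finset.mul_sum, hR.2, hP.2]
  ring

/-- Changing the first factor of a product pmf changes the `χ²`-divergence by that of the
factor. -/
theorem chiSqSum_prod_cons {n : ℕ} {R P : α → ℝ} (hR : R ∈ stdSimplex ℝ α)
    (hP : P ∈ stdSimplex ℝ α) (hpos : ∀ x, 0 < P x) :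
    chiSqSum (fun x : Fin (n + 1) → α =>
      ∏ i, (Fin.cons R (fun _ => P) : Fin (n + 1) → α → ℝ) i (x i)) (fun x => ∏ i, P (x i)) =
      chiSqSum R P := by
  have hmem : ∀ i, (Fin.cons R (fun _ => P) : Fin (n + 1) → α → ℝ) i ∈ stdSimplex ℝ α := by
    intro i
    refine Fin.cases ?_ (fun j => ?_) i
    · simpa using hR
    · simpa using hP
  rw [chiSqSum_eq_sum_sq_div_sub_one (prod_mem_stdSimplex hmem)
    (prod_mem_stdSimplex fun _ => hP) fun x => Finset.prod_pos fun i _ => hpos _,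
    chiSqSum_eq_sum_sq_div_sub_one hR hP hpos]
  congr 1
  simp only [← Finset.prod_pow, ← Finset.prod_div_distrib]
  rw [← Fintype.prod_sum fun i a =>
    (Fin.cons R (fun _ => P) : Fin (n + 1) → α → ℝ) i a ^ 2 / P a, Fin.prod_univ_succ]
  simp only [Fin.cons_zero, Fin.cons_succ]
  -- Each unchanged factor contributes `1`.
  have : ∑ a, P a ^ 2 / P a = 1 := by
    rw [← hP.2]
    refine Finset.sum_congr rfl fun a _ => ?_
    rw [sq, mul_div_cancel_right₀ _ (hpos a).ne']
  rw [this, Finset.prod_const_one, mul_one]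

/-- Test on product pmfs that differ from the reference in the first letter only. This needs at
least one letter, hence `n + 1`. -/
theorem ChiSqContracts.of_memoryless {P : α → ℝ} {W : Matrix β α ℝ} {c : ℝ} {n : ℕ}
    (hP : P ∈ stdSimplex ℝ α) (hpos : ∀ x, 0 < P x) (hW : IsColumnStochastic W)
    (hWpos : ∀ y, 0 < (W *ᵥ P) y)
    (h : ChiSqContracts (fun x : Fin (n + 1) → α => ∏ i, P (x i))
      (memorylessChannel (n + 1) W) c) :
    ChiSqContracts P W c := by
  intro R hR
  have hmem : ∀ i, (Fin.cons R (fun _ => P) : Fin (n + 1) → α → ℝ) i ∈ stdSimplex ℝ α := by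
    intro i
    refine Fin.cases ?_ (fun j => ?_) i
    · simpa using hR
    · simpa using hP
  have := h _ (prod_mem_stdSimplex hmem)
  rw [memoryless_mulVec_prod, memoryless_mulVec_prod W fun _ => P,
    chiSqSum_prod_cons hR hP hpos] at this
  have e : (fun y : Fin (n + 1) → β =>
      ∏ i, (W *ᵥ (Fin.cons R (fun _ => P) : Fin (n + 1) → α → ℝ) i) (y i)) =
      fun y => ∏ i, (Fin.cons (W *ᵥ R) (fun _ => W *ᵥ P) : Fin (n + 1) → β → ℝ) i (y i) := by
    funext y
    simp [Fin.prod_univ_succ]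
  rwa [e, chiSqSum_prod_cons (hW.mulVec_mem hR) (hW.mulVec_mem hP) hWpos] at this

/-- For memoryless extensions, the KL contraction coefficient is at most the `χ²` contraction
coefficient divided by the smallest probability of a single input letter. -/
theorem etaKL_memoryless_le {P : α → ℝ} {W : Matrix β α ℝ} {m : ℝ}
    (hP : P ∈ stdSimplex ℝ α) (hpos : ∀ x, 0 < P x) (hW : IsColumnStochastic W)
    (hWpos : ∀ y, 0 < (W *ᵥ P) y) (hm0 : 0 < m) (hm : ∀ x, m ≤ P x) (n : ℕ) :
    etaKL (fun x : Fin n → α => ∏ i, P (x i)) (memorylessChannel n W) ≤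
      etaChiSq (fun x : Fin n → α => ∏ i, P (x i)) (memorylessChannel n W) / ENNReal.ofReal m := by
  have hposn : ∀ x : Fin n → α, 0 < ∏ i, P (x i) := fun x => Finset.prod_pos fun i _ => hpos _
  have hWposn : ∀ y, 0 < (memorylessChannel n W *ᵥ fun x : Fin n → α => ∏ i, P (x i)) y := by
    intro y
    rw [memoryless_mulVec_prod W fun _ => P]
    exact Finset.prod_pos fun i _ => hWpos _
  cases n with
  -- With no letters there is no restriction to one letter, but the input space is a point and
  -- constant `0` works.
  | zero =>
    have h0 : KLContracts (fun x : Fin 0 → α => ∏ i, P (x i)) (memorylessChannel 0 W) 0 := by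
      intro R hR
      have hR1 : R = fun x : Fin 0 → α => ∏ i, P (x i) := by
        funext x
        have := hR.2
        rw [Fintype.sum_unique] at this
        rw [Subsingleton.elim x default, this]
        simp
      rw [hR1, klSum_self, zero_mul]
    exact (etaKL_le hposn hWposn h0).trans (by simp)
  | succ n =>
    by_cases hfin :
        etaChiSq (fun x : Fin (n + 1) → α => ∏ i, P (x i)) (memorylessChannel (n + 1) W) = ⊤
    · rw [hfin, ENNReal.top_div_of_ne_top ENNReal.ofReal_ne_top]
      exact le_top
    -- From χ² on `n + 1` letters to χ² on one, then to KL on one with the loss `1 / m`, then back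
    -- to KL on `n + 1`.
    · have h1 := ((chiSqContracts_toReal_etaChiSq hposn hWposn hfin).of_memoryless hP hpos hW
        hWpos).klContracts hP hpos hW hWpos ENNReal.toReal_nonneg hm0 hm
      refine (etaKL_le hposn hWposn (h1.memoryless (by positivity) hpos hW hWpos _)).trans ?_
      rw [ENNReal.ofReal_div_of_pos hm0, ENNReal.ofReal_toReal hfin]

end Memoryless

/-! ### Joint law of i.i.d. pairs -/

section Joint

theorem jointPmf_pi_of_iIndepFun {𝒳 𝒴 Ω : Type*}
    [MeasurableSpace 𝒳] [MeasurableSingletonClass 𝒳]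
    [MeasurableSpace 𝒴] [MeasurableSingletonClass 𝒴]
    [MeasurableSpace Ω] {μ : Measure Ω} {n : ℕ} {X : Fin n → Ω → 𝒳} {Y : Fin n → Ω → 𝒴}
    (hindep : iIndepFun (fun i ω => (X i ω, Y i ω)) μ)
    (p : (Fin n → 𝒳) × (Fin n → 𝒴)) :
    jointPmf μ (fun ω i => X i ω) (fun ω i => Y i ω) p =
      ∏ i, jointPmf μ (X i) (Y i) (p.1 i, p.2 i) := by
  have h := hindep.measure_inter_preimage_eq_mul Finset.univ
    (sets := fun i => {(p.1 i, p.2 i)}) fun i _ => measurableSet_singleton _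
  have e : {ω | (fun i => X i ω) = p.1 ∧ (fun i => Y i ω) = p.2} =
      ⋂ i ∈ Finset.univ, (fun ω => (X i ω, Y i ω)) ⁻¹' {(p.1 i, p.2 i)} := by
    ext ω
    simp [funext_iff, forall_and]
  have e' : ∀ i, {ω | X i ω = p.1 i ∧ Y i ω = p.2 i} =
      (fun ω => (X i ω, Y i ω)) ⁻¹' {(p.1 i, p.2 i)} := by
    intro i
    ext ω
    simp
  simp only [jointPmf, measureReal_def, e, e', h, ENNReal.toReal_prod]

variable {α β : Type*} [Fintype β]

theorem marginalX_mem [Fintype α] {P : α × β → ℝ} (hP : P ∈ stdSimplex ℝ (α × β)) :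
    marginalX P ∈ stdSimplex ℝ α :=
  ⟨fun x => Finset.sum_nonneg fun y _ => hP.1 (x, y),
    by rw [← hP.2, Fintype.sum_prod_type]; rfl⟩

theorem isColumnStochastic_channel {P : α × β → ℝ} (hP : ∀ p, 0 ≤ P p)
    (hPX : ∀ x, 0 < marginalX P x) : IsColumnStochastic (channel P) := by
  refine ⟨fun y x => div_nonneg (hP _) (hPX x).le, fun x => ?_⟩
  simp only [channel, Matrix.of_apply]
  rw [← Finset.sum_div]
  exact div_self (hPX x).ne'

/-- Through this identity, full support of `P_Y` makes the output pmf positive. -/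
theorem channel_mulVec_marginalX [Fintype α] {P : α × β → ℝ} (hPX : ∀ x, 0 < marginalX P x) :
    channel P *ᵥ marginalX P = marginalY P := by
  funext y
  refine Finset.sum_congr rfl fun x _ => ?_
  exact div_mul_cancel₀ _ (hPX x).ne'

theorem marginalX_prod (P : α × β → ℝ) (n : ℕ) :
    marginalX (fun p : (Fin n → α) × (Fin n → β) => ∏ i, P (p.1 i, p.2 i)) =
      fun x => ∏ i, marginalX P (x i) := by
  funext x
  exact (Fintype.prod_sum fun i y => P (x i, y)).symm

theorem channel_prod (P : α × β → ℝ) (n : ℕ) :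
    channel (fun p : (Fin n → α) × (Fin n → β) => ∏ i, P (p.1 i, p.2 i)) =
      memorylessChannel n (channel P) := by
  ext y x
  simp only [channel, memorylessChannel, Matrix.of_apply, marginalX_prod, Finset.prod_div_distrib]

end Joint

theorem corollary1 {𝒳 𝒴 Ω : Type*}
    [Fintype 𝒳] [MeasurableSpace 𝒳] [MeasurableSingletonClass 𝒳]
    [Fintype 𝒴] [MeasurableSpace 𝒴] [MeasurableSingletonClass 𝒴]
    -- the joint pmf `P_{X,Y}`, with marginals of full support
    (P : 𝒳 × 𝒴 → ℝ) (hP : P ∈ stdSimplex ℝ (𝒳 × 𝒴))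
    (hPX : ∀ x, 0 < marginalX P x) (hPY : ∀ y, 0 < marginalY P y)
    -- the i.i.d. pairs `(X_1, Y_1), …, (X_n, Y_n)`
    [MeasurableSpace Ω] (μ : Measure Ω) [IsProbabilityMeasure μ] (n : ℕ)
    (X : Fin n → Ω → 𝒳) (Y : Fin n → Ω → 𝒴)
    (hX : ∀ i, Measurable (X i)) (hY : ∀ i, Measurable (Y i))
    (hindep : iIndepFun (fun i ω => (X i ω, Y i ω)) μ)
    (hlaw : ∀ i, jointPmf μ (X i) (Y i) = P)
    -- the joint pmf of `(X_1, …, X_n)` and `(Y_1, …, Y_n)`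
    (Pn : (Fin n → 𝒳) × (Fin n → 𝒴) → ℝ)
    (hPn : Pn = jointPmf μ (fun ω i => X i ω) (fun ω i => Y i ω)) :
    etaChiSq (marginalX Pn) (channel Pn) ≤ etaKL (marginalX Pn) (channel Pn) ∧
      etaKL (marginalX Pn) (channel Pn) ≤
        etaChiSq (marginalX Pn) (channel Pn) / ENNReal.ofReal (⨅ x, marginalX P x) := by
  have hprod : Pn = fun p => ∏ i, P (p.1 i, p.2 i) := by
    funext p
    rw [hPn, jointPmf_pi_of_iIndepFun hindep]
    simp only [hlaw]
  rw [hprod, marginalX_prod, channel_prod]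
  have hPXmem := marginalX_mem hP
  have hW := isColumnStochastic_channel hP.1 hPX
  have hWpos : ∀ y, 0 < (channel P *ᵥ marginalX P) y := by
    rw [channel_mulVec_marginalX hPX]
    exact hPY
  have : Nonempty 𝒳 := by
    by_contra hne
    rw [not_nonempty_iff] at hne
    have := hPXmem.2
    rw [Finset.univ_eq_empty, Finset.sum_empty] at this
    exact zero_ne_one this
  constructor
  · refine etaChiSq_le_etaKL (prod_mem_stdSimplex fun _ => hPXmem)
      (fun x => Finset.prod_pos fun i _ => hPX _) (hW.memoryless n) fun y => ?_
    rw [memoryless_mulVec_prod _ fun _ => marginalX P]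
    exact Finset.prod_pos fun i _ => hWpos _
  · refine etaKL_memoryless_le hPXmem hPX hW hWpos ?_
      (fun x => ciInf_le (Set.finite_range _).bddBelow x) n
    -- The infimum over a finite nonempty alphabet is attained, hence positive.
    obtain ⟨x, hx⟩ := exists_eq_ciInf_of_finite (f := marginalX P)
    rw [← hx]
    exact hPX x
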